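/- **Definitions.** Let $\mathcal I\subseteq\mathbb R$ be an interval with more than one point. For continuous $E,F:\mathcal I\to\mathbb R^{m\times m}$ put $N(t)=\ker E(t)$ and $S(t)=\{z\in\mathbb R^m: F(t)z\in\operatorname{im}E(t)\}$. The pair $\{E,F\}$ is *pre-regular* (with constants $r,\theta$) if $\operatorname{im}[E(t)\ F(t)]=\mathbb R^m$, $\operatorname{rank}E(t)=r$ and $\dim (N(t)\cap S(t))=\theta$ for all $t\in\mathcal I$. A *reduction step* takes a pre-regular pair $\{E_i,F_i\}$ of size $m_i$ with constants $r_i,\theta_i$ to the pair $$E_{i+1}=Y_i^{*}E_iC_i,\qquad F_{i+1}=Y_i^{*}(F_iC_i+E_iC_i')$$ of size $m_{i+1}=r_i$, where the columns of the continuous function $Y_i$ form a basis of $\operatorname{im}E_i$ and those of the continuously differentiable function $C_i$ form a basis of $S_i=\{z: F_iz\in\operatorname{im}E_i\}$, pointwise on $\mathcal I$. The pair $\{E,F\}=\{E_0,F_0\}$ of size $m_0=m$ is *regular* with index $\mu\ge 1$ and characteristic values $m>r_0>r_1>\cdots>r_{\mu-1}=r_\mu$ and $\theta_0,\dots,\theta_{\mu-1}$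 if the reduction can be carried out up to level $\mu-1$, each pair $\{E_i,F_i\}$, $i=0,\dots,\mu-1$, is pre-regular with constants $r_i,\theta_i$, and, in case $r_{\mu-1}>0$, the step from level $\mu-1$ can be carried out as well and gives a pointwise nonsingular $E_\mu$. **Statement.** Let $E,F\in\mathbb R^{m\times m}$ be constant matrices such that the pair $\{E,F\}$, regarded as a pair of constant functions on $\mathcal I$, is regular with index $\mu$ and characteristic values $r_i,\theta_i$. Then the matrix pencil $\lambda E+F$ is regular, i.e. the polynomial $\det(\lambda E+F)$ does not vanish identically. Hence $\{E,F\}$ has a Weierstraß–Kronecker form, i.e. there are $d,n\ge 0$ with $d+n=m$, nonsingular $L,K\in\mathbb R^{m\times m}$, a matrix $\mathcal W\in\mathbb R^{d\times d}$ and a nilpotent matrix $\mathcal N\in\mathbb R^{n\times n}$ with $$LEK=\begin{bmatrix}I_d&\\&\mathcal N\end{bmatrix},\qquad LFK=\begin{bmatrix}\mathcal W&\\&I_n\end{bmatrix}.$$ In every such form, $\mathcal N$ has nilpotency index $\mu$ and is similar to a block diagonal matrix of nilpotent Jordan blocks, and, for each $i=0,\dots,\mu-2$, the quantity $\theta_i$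 equals the number of blocks of order $\ge i+2$ in every such Jordan form of $\mathcal N$. -/

import Mathlib

namespace DAE

/-- The columns of `B` form a basis of the subspace `U`. -/
def IsBasisMatrix {m k : ℕ} (B : Matrix (Fin m) (Fin k) ℝ) (U : Submodule ℝ (Fin m → ℝ)) : Prop :=
  LinearIndependent ℝ B.col ∧ LinearMap.range B.mulVecLin = U

/-- `N = ker E`. -/
def kerSpace {m : ℕ} (E : Matrix (Fin m) (Fin m) ℝ) : Submodule ℝ (Fin m → ℝ) :=
  LinearMap.ker E.mulVecLin

/-- `S = {z | F z ∈ im E}` (which is `ker Zᵀ F` for every basis `Z` of the orthogonal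
complement of `im E`). -/
def obviousSpace {m : ℕ} (E F : Matrix (Fin m) (Fin m) ℝ) : Submodule ℝ (Fin m → ℝ) :=
  (LinearMap.range E.mulVecLin).comap F.mulVecLin

/-- The continuous pair `{E, F}` of matrix functions is pre-regular on `I` with constants
`r` and `θ`: pointwise `im [E F] = ℝᵐ`, `rank E = r`, `dim (N ∩ S) = θ`. -/
structure IsPreRegular (I : Set ℝ) {m : ℕ} (E F : ℝ → Matrix (Fin m) (Fin m) ℝ) (r θ : ℕ) :
    Prop where
  continuousOn_left : ContinuousOn E I
  continuousOn_right : ContinuousOn F I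
  range_eq_top : ∀ t ∈ I, LinearMap.range (Matrix.fromCols (E t) (F t)).mulVecLin = ⊤
  rank_eq : ∀ t ∈ I, (E t).rank = r
  finrank_eq : ∀ t ∈ I,
    Module.finrank ℝ (kerSpace (E t) ⊓ obviousSpace (E t) (F t) : Submodule ℝ (Fin m → ℝ)) = θ

/-- The entrywise derivative on `I` of a matrix function (one-sided at an end point of `I`). -/
noncomputable def matrixDeriv (I : Set ℝ) {m k : ℕ} (C : ℝ → Matrix (Fin m) (Fin k) ℝ) (t : ℝ) :
    Matrix (Fin m) (Fin k) ℝ :=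
  Matrix.of fun i j => derivWithin (fun s => C s i j) I t

/-- One reduction step on `I`: `Y` is a continuous basis of `im E`, `C` is a continuously
differentiable basis of `S`, and the new pair, of size `k`, is
`E' = Yᵀ E C`, `F' = Yᵀ (F C + E Ċ)`. -/
structure IsReductionStep (I : Set ℝ) {m k : ℕ} (E F : ℝ → Matrix (Fin m) (Fin m) ℝ)
    (Y C : ℝ → Matrix (Fin m) (Fin k) ℝ) (E' F' : ℝ → Matrix (Fin k) (Fin k) ℝ) : Prop where
  continuousOn : ContinuousOn Y I
  contDiffOn : ∀ i j, ContDiffOn ℝ 1 (fun t => C t i j) I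
  basis_range : ∀ t ∈ I, IsBasisMatrix (Y t) (LinearMap.range (E t).mulVecLin)
  basis_obvious : ∀ t ∈ I, IsBasisMatrix (C t) (obviousSpace (E t) (F t))
  left_eq : ∀ t ∈ I, E' t = (Y t).transpose * E t * C t
  right_eq : ∀ t ∈ I, F' t = (Y t).transpose * (F t * C t + E t * matrixDeriv I C t)

/-- The size `m_i` of the pair at level `i`: `m_0 = m` and `m_{i+1} = r_i`. -/
def levelSize (m : ℕ) (r : ℕ → ℕ) : ℕ → ℕ
  | 0 => m
  | i + 1 => r i

/-- The pair `{E, F}` is regular on `I` with index `μ` and characteristic values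
`m > r_0 > ⋯ > r_{μ-1} = r_μ` and `θ_0, …, θ_{μ-1}`. The reduction procedure is carried out with
some choice of bases; the values of `r` beyond `μ` and of `θ` beyond `μ - 1` are irrelevant, and
so are `Es i`, `Fs i` beyond the last level that is reached. -/
def IsRegular (I : Set ℝ) {m : ℕ} (E F : ℝ → Matrix (Fin m) (Fin m) ℝ) (μ : ℕ) (r θ : ℕ → ℕ) :
    Prop :=
  1 ≤ μ ∧ r 0 < m ∧ (∀ i, i + 1 < μ → r (i + 1) < r i) ∧ r μ = r (μ - 1) ∧
  ∃ (Es Fs : ∀ i, ℝ → Matrix (Fin (levelSize m r i)) (Fin (levelSize m r i)) ℝ)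
    (Y C : ∀ i, ℝ → Matrix (Fin (levelSize m r i)) (Fin (r i)) ℝ),
    Es 0 = E ∧ Fs 0 = F ∧
    (∀ i, i < μ → IsPreRegular I (Es i) (Fs i) (r i) (θ i)) ∧
    (∀ i, i + 1 < μ → IsReductionStep I (Es i) (Fs i) (Y i) (C i) (Es (i + 1)) (Fs (i + 1))) ∧
    (0 < r (μ - 1) →
      IsReductionStep I (Es (μ - 1)) (Fs (μ - 1)) (Y (μ - 1)) (C (μ - 1))
        (Es (μ - 1 + 1)) (Fs (μ - 1 + 1)) ∧
      ∀ t ∈ I, IsUnit (Es (μ - 1 + 1) t).det)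

/-- The pencil `λ E + F` is regular: the polynomial `det (λ E + F)` is not zero. -/
def IsRegularPencil {m : ℕ} (E F : Matrix (Fin m) (Fin m) ℝ) : Prop :=
  ((Polynomial.X : Polynomial ℝ) • E.map Polynomial.C + F.map Polynomial.C).det ≠ 0

/-- The block diagonal `m × m` matrix `diag (A, B)`, where `m = d + n`. -/
def diagBlocks {m d n : ℕ} (h : d + n = m) (A : Matrix (Fin d) (Fin d) ℝ)
    (B : Matrix (Fin n) (Fin n) ℝ) : Matrix (Fin m) (Fin m) ℝ :=
  Matrix.reindex (finSumFinEquiv.trans (finCongr h)) (finSumFinEquiv.trans (finCongr h))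
    (Matrix.fromBlocks A 0 0 B)

/-- A Weierstraß–Kronecker form of `{E, F}` with blocks `W` and `N`:
`L E K = diag (I, N)` and `L F K = diag (W, I)` with `L`, `K` nonsingular and `N` nilpotent. -/
def IsWeierstrassKroneckerForm {m d n : ℕ} (h : d + n = m) (E F : Matrix (Fin m) (Fin m) ℝ)
    (W : Matrix (Fin d) (Fin d) ℝ) (N : Matrix (Fin n) (Fin n) ℝ) : Prop :=
  IsNilpotent N ∧ ∃ L K : Matrix (Fin m) (Fin m) ℝ, IsUnit L.det ∧ IsUnit K.det ∧
    L * E * K = diagBlocks h 1 N ∧ L * F * K = diagBlocks h W 1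

/-- The Jordan block of order `k` with eigenvalue `0`. -/
def nilpotentJordanBlock (k : ℕ) : Matrix (Fin k) (Fin k) ℝ :=
  Matrix.of fun i j => if (i : ℕ) + 1 = (j : ℕ) then 1 else 0

/-- The matrix `N` is similar to the block diagonal matrix of `s` Jordan blocks with eigenvalue
`0`, of orders `k 0, …, k (s - 1) ≥ 1`. -/
def HasNilpotentJordanForm {n s : ℕ} (N : Matrix (Fin n) (Fin n) ℝ) (k : Fin s → ℕ) : Prop :=
  (∀ a, 1 ≤ k a) ∧ ∃ (e : (Σ a : Fin s, Fin (k a)) ≃ Fin n) (P : Matrix (Fin n) (Fin n) ℝ),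
    IsUnit P.det ∧
    N * P = P * Matrix.reindex e e (Matrix.blockDiagonal' fun a => nilpotentJordanBlock (k a))

end DAE

/-! ### The reduction of a constant pair, read off from its Wong sequence -/

namespace DAE

open Module

/-! For constant `E`, `F` the reduction follows the fixed subspaces `X 0 = ⊤`, `X (i + 1) = {x ∈ X i
| F x ∈ E (X i)}` (`wongSpace`), although the chosen bases may vary with `t`. The pair at level `i`
is `L E K`, `L (F K + E K')`, where `K t` is a basis of `X i` and `L t` is injective on a subspace
containing `E (X i)` and `F (X i)`. A moving basis of a fixed subspace has its derivative in that
subspace, so `E K'` takes values in `E (X i)` and does not affect membership in the image of `E` at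
that level. Hence (`IsRegular.wongSpace`) `dim X i = m_i`, `θ_i = dim (ker E ∩ X (i + 1))` and `ker
E ∩ X μ = 0`.

The kernel of `c E + F` lies in every `X i`. As `E` is injective on `X μ`, a nonzero kernel vector
is an eigenvector of a fixed endomorphism of `X μ`, which excludes only finitely many `c`. So the
pencil is regular, and Fitting's decomposition of `(c E + F)⁻¹ E` gives the Weierstraß–Kronecker
form.

In any such form `X i` becomes `ℝᵈ × im Nⁱ`, and `ker E ∩ X i` becomes `ker N ∩ im Nⁱ`. Triviality
of the latter at `i = μ` gives `N ^ μ = 0`; the strict drop of dimension from `X (μ - 1)` to `X μ`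
gives `N ^ (μ - 1) ≠ 0`. Finally `dim (ker N ∩ im Nʲ)` counts the Jordan blocks of order at least `j
+ 1`, and `θ_i` is the case `j = i + 1`. -/

/-- The decreasing sequence `X 0 = ⊤`, `X (i + 1) = {x ∈ X i | F x ∈ E (X i)}`. -/
def wongSpace {V W : Type*} [AddCommGroup V] [Module ℝ V] [AddCommGroup W] [Module ℝ W]
    (E F : V →ₗ[ℝ] W) : ℕ → Submodule ℝ V
  | 0 => ⊤
  | i + 1 => wongSpace E F i ⊓ ((wongSpace E F i).map E).comap F

/-- The pair `{E', F'}` of matrix functions has the form `E' = L E K`, `F' = L (F K + E K')`, where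
`K` is a basis of `X` and `L` is injective on `Z`. -/
def IsReducedTo (I : Set ℝ) {m k : ℕ} (E F : Matrix (Fin m) (Fin m) ℝ)
    (X Z : Submodule ℝ (Fin m → ℝ)) (E' F' : ℝ → Matrix (Fin k) (Fin k) ℝ) : Prop :=
  ∃ (K : ℝ → Matrix (Fin m) (Fin k) ℝ) (L : ℝ → Matrix (Fin k) (Fin m) ℝ),
    (∀ i j, ContDiffOn ℝ 1 (fun t => K t i j) I) ∧
    (∀ t ∈ I, Function.Injective (K t).mulVecLin) ∧
    (∀ t ∈ I, LinearMap.range (K t).mulVecLin = X) ∧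
    (∀ t ∈ I, ∀ z ∈ Z, (L t).mulVec z = 0 → z = 0) ∧
    (∀ t ∈ I, E' t = L t * E * K t) ∧
    (∀ t ∈ I, F' t = L t * (F * K t + E * matrixDeriv I K t))

theorem hasDerivWithinAt_matrixDeriv {I : Set ℝ} {m k : ℕ} {K : ℝ → Matrix (Fin m) (Fin k) ℝ}
    (hK : ∀ i j, ContDiffOn ℝ 1 (fun t => K t i j) I) {t : ℝ} (ht : t ∈ I) (i : Fin m)
    (j : Fin k) : HasDerivWithinAt (fun s => K s i j) (matrixDeriv I K t i j) I t :=
  ((hK i j).differentiableOn one_ne_zero t ht).hasDerivWithinAt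

theorem matrixDeriv_mul {I : Set ℝ} (hI : UniqueDiffOn ℝ I) {m k l : ℕ}
    {K : ℝ → Matrix (Fin m) (Fin k) ℝ} {C : ℝ → Matrix (Fin k) (Fin l) ℝ}
    (hK : ∀ i j, ContDiffOn ℝ 1 (fun t => K t i j) I)
    (hC : ∀ i j, ContDiffOn ℝ 1 (fun t => C t i j) I) {t : ℝ} (ht : t ∈ I) :
    matrixDeriv I (fun s => K s * C s) t
      = matrixDeriv I K t * C t + K t * matrixDeriv I C t := by
  ext i j
  have h : HasDerivWithinAt (fun s => (K s * C s) i j)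
      (∑ a, (matrixDeriv I K t i a * C t a j + K t i a * matrixDeriv I C t a j)) I t := by
    simp only [Matrix.mul_apply]
    exact HasDerivWithinAt.fun_sum fun a _ =>
      (hasDerivWithinAt_matrixDeriv hK ht i a).mul (hasDerivWithinAt_matrixDeriv hC ht a j)
  rw [Matrix.add_apply, Matrix.mul_apply, Matrix.mul_apply, ← Finset.sum_add_distrib]
  exact h.derivWithin (hI t ht)

/-- The derivative of a curve in a subspace lies in the subspace. -/
theorem matrixDeriv_mulVec_mem {I : Set ℝ} (hI : UniqueDiffOn ℝ I) {m k : ℕ}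
    {K : ℝ → Matrix (Fin m) (Fin k) ℝ} {X : Submodule ℝ (Fin m → ℝ)}
    (hK : ∀ i j, ContDiffOn ℝ 1 (fun t => K t i j) I)
    (hX : ∀ t ∈ I, LinearMap.range (K t).mulVecLin = X) {t : ℝ} (ht : t ∈ I) (z : Fin k → ℝ) :
    (matrixDeriv I K t).mulVec z ∈ X := by
  by_contra hz
  -- A functional `f` vanishing on `X` is zero along the whole curve, so its derivative vanishes
  -- too, whereas `f` is nonzero at the derivative of the curve.
  obtain ⟨f, hfz, hf⟩ := Submodule.exists_le_ker_of_notMem hz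
  have hd : HasDerivWithinAt (fun s => (K s).mulVec z) ((matrixDeriv I K t).mulVec z) I t := by
    rw [hasDerivWithinAt_pi]
    intro i
    simp only [Matrix.mulVec, dotProduct]
    exact HasDerivWithinAt.fun_sum fun a _ =>
      (hasDerivWithinAt_matrixDeriv hK ht i a).mul_const (z a)
  have h1 := (LinearMap.toContinuousLinearMap f).hasFDerivAt.comp_hasDerivWithinAt t hd
  have h2 : HasDerivWithinAt (LinearMap.toContinuousLinearMap f ∘ fun s => (K s).mulVec z) 0 I t :=
    (hasDerivWithinAt_const t I (0 : ℝ)).congr_of_mem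
      (fun s hs => hf (hX s hs ▸ LinearMap.mem_range_self (K s).mulVecLin z)) ht
  exact hfz ((hI t ht).eq_deriv _ h1 h2)

/-- Gram matrix argument: `Yᵀ Y w = 0` forces `Y w = 0`. It keeps the left factors injective when a
step multiplies by `Yᵀ`. -/
theorem mulVec_transpose_injOn_range {m k : ℕ} {Y : Matrix (Fin m) (Fin k) ℝ} {v : Fin m → ℝ}
    (hv : v ∈ LinearMap.range Y.mulVecLin) (h : Y.transpose.mulVec v = 0) : v = 0 := by
  obtain ⟨w, rfl⟩ := hv
  rw [Matrix.mulVecLin_apply, Matrix.mulVec_mulVec] at h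
  have := (Matrix.conjTranspose_mul_self_mulVec_eq_zero Y w).1 (by simpa using h)
  simpa using this

section
variable {I : Set ℝ} {m k l : ℕ} {E F : Matrix (Fin m) (Fin m) ℝ} {X Z : Submodule ℝ (Fin m → ℝ)}
  {E' F' : ℝ → Matrix (Fin k) (Fin k) ℝ}

theorem IsReducedTo.finrank_eq (hne : I.Nonempty) (h : IsReducedTo I E F X Z E' F') :
    finrank ℝ X = k := by
  obtain ⟨K, L, -, hinj, hX, -⟩ := h
  obtain ⟨t, ht⟩ := hne
  rw [← hX t ht, LinearMap.finrank_range_of_inj (hinj t ht)]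
  simp

/-- Both `y` and `E (X)` lie in `Z`, where `L` is injective, so `L` can be cancelled. -/
theorem mem_range_reduced {K : Matrix (Fin m) (Fin k) ℝ} {L : Matrix (Fin k) (Fin m) ℝ}
    (hEZ : X.map E.mulVecLin ≤ Z) (hX : LinearMap.range K.mulVecLin = X)
    (hL : ∀ z ∈ Z, L.mulVec z = 0 → z = 0) {y : Fin m → ℝ} (hy : y ∈ Z) :
    L.mulVec y ∈ LinearMap.range (L * E * K).mulVecLin ↔ y ∈ X.map E.mulVecLin := by
  constructor
  · rintro ⟨w, hw⟩
    have hKw : K.mulVec w ∈ X := hX ▸ LinearMap.mem_range_self K.mulVecLin w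
    have hm : E.mulVec (K.mulVec w) ∈ X.map E.mulVecLin := Submodule.mem_map_of_mem hKw
    have h0 := hL (y - E.mulVec (K.mulVec w)) (Z.sub_mem hy (hEZ hm)) (by
      rw [Matrix.mulVec_sub, ← hw]
      simp [Matrix.mulVec_mulVec, Matrix.mul_assoc])
    rwa [sub_eq_zero.1 h0]
  · rintro ⟨x, hx, rfl⟩
    rw [← hX] at hx
    obtain ⟨w, rfl⟩ := hx
    exact ⟨w, by simp [Matrix.mulVec_mulVec, Matrix.mul_assoc]⟩

/-- Here the derivative term, played by `D`, disappears: `E D z` already lies in `E (X)`, so adding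
it to `F K z` does not change membership there. -/
theorem mem_obviousSpace_reduced {K D : Matrix (Fin m) (Fin k) ℝ} {L : Matrix (Fin k) (Fin m) ℝ}
    (hEZ : X.map E.mulVecLin ≤ Z) (hFZ : X.map F.mulVecLin ≤ Z)
    (hX : LinearMap.range K.mulVecLin = X) (hD : ∀ z, D.mulVec z ∈ X)
    (hL : ∀ z ∈ Z, L.mulVec z = 0 → z = 0) (z : Fin k → ℝ) :
    z ∈ obviousSpace (L * E * K) (L * (F * K + E * D)) ↔
      K.mulVec z ∈ X ⊓ (X.map E.mulVecLin).comap F.mulVecLin := by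
  have hKz : K.mulVec z ∈ X := hX ▸ LinearMap.mem_range_self K.mulVecLin z
  have hED : E.mulVec (D.mulVec z) ∈ X.map E.mulVecLin := Submodule.mem_map_of_mem (hD z)
  have hFK : F.mulVec (K.mulVec z) ∈ Z := hFZ (Submodule.mem_map_of_mem hKz)
  have key : (L * (F * K + E * D)).mulVecLin z
      = L.mulVec (F.mulVec (K.mulVec z) + E.mulVec (D.mulVec z)) := by
    simp [Matrix.mulVec_mulVec, Matrix.mulVec_add, Matrix.mul_add]
  rw [obviousSpace, Submodule.mem_comap, key,
    mem_range_reduced hEZ hX hL (Z.add_mem hFK (hEZ hED)), Submodule.add_mem_iff_left _ hED]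
  exact ⟨fun h => ⟨hKz, h⟩, fun h => h.2⟩

theorem mem_kerSpace_reduced {K : Matrix (Fin m) (Fin k) ℝ} {L : Matrix (Fin k) (Fin m) ℝ}
    (hEZ : X.map E.mulVecLin ≤ Z) (hX : LinearMap.range K.mulVecLin = X)
    (hL : ∀ z ∈ Z, L.mulVec z = 0 → z = 0) (z : Fin k → ℝ) :
    z ∈ kerSpace (L * E * K) ↔ K.mulVec z ∈ LinearMap.ker E.mulVecLin := by
  have hKz : K.mulVec z ∈ X := hX ▸ LinearMap.mem_range_self K.mulVecLin z
  have h1 : (L * E * K).mulVec z = L.mulVec (E.mulVec (K.mulVec z)) := by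
    simp [Matrix.mulVec_mulVec, Matrix.mul_assoc]
  rw [kerSpace, LinearMap.mem_ker, LinearMap.mem_ker, Matrix.mulVecLin_apply,
    Matrix.mulVecLin_apply, h1]
  exact ⟨hL _ (hEZ (Submodule.mem_map_of_mem hKz)), fun h => by rw [h, Matrix.mulVec_zero]⟩

theorem IsReducedTo.finrank_ker_inf (hI : UniqueDiffOn ℝ I) (h : IsReducedTo I E F X Z E' F')
    (hEZ : X.map E.mulVecLin ≤ Z) (hFZ : X.map F.mulVecLin ≤ Z) {t : ℝ} (ht : t ∈ I) :
    finrank ℝ (LinearMap.ker E.mulVecLin ⊓ (X ⊓ (X.map E.mulVecLin).comap F.mulVecLin) :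
      Submodule ℝ (Fin m → ℝ)) =
    finrank ℝ (kerSpace (E' t) ⊓ obviousSpace (E' t) (F' t) : Submodule ℝ (Fin k → ℝ)) := by
  obtain ⟨K, L, hK, hinj, hX, hL, hE, hF⟩ := h
  have hD := matrixDeriv_mulVec_mem hI hK hX ht
  rw [hE t ht, hF t ht, (Submodule.equivMapOfInjective _ (hinj t ht) _).finrank_eq]
  refine congrArg (fun S : Submodule ℝ (Fin m → ℝ) => finrank ℝ S) ?_
  ext x
  constructor
  · rintro ⟨hx, hxX⟩
    obtain ⟨z, rfl⟩ := (hX t ht).symm ▸ hxX.1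
    exact ⟨z, ⟨(mem_kerSpace_reduced hEZ (hX t ht) (hL t ht) z).2 hx,
      (mem_obviousSpace_reduced hEZ hFZ (hX t ht) hD (hL t ht) z).2 hxX⟩, rfl⟩
  · rintro ⟨z, ⟨hz, hz'⟩, rfl⟩
    exact ⟨(mem_kerSpace_reduced hEZ (hX t ht) (hL t ht) z).1 hz,
      (mem_obviousSpace_reduced hEZ hFZ (hX t ht) hD (hL t ht) z).1 hz'⟩

/-- The new factors are `K C` and `Yᵀ L`. The product rule for `(K C)'` absorbs the term `E' C'` of
the reduction step, and `Yᵀ` is injective on `im E'`, which contains `L (E (X))`. -/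
theorem IsReducedTo.step (hI : UniqueDiffOn ℝ I) (h : IsReducedTo I E F X Z E' F')
    (hEZ : X.map E.mulVecLin ≤ Z) (hFZ : X.map F.mulVecLin ≤ Z)
    {Y C : ℝ → Matrix (Fin k) (Fin l) ℝ} {E'' F'' : ℝ → Matrix (Fin l) (Fin l) ℝ}
    (hs : IsReductionStep I E' F' Y C E'' F'') :
    IsReducedTo I E F (X ⊓ (X.map E.mulVecLin).comap F.mulVecLin) (X.map E.mulVecLin) E'' F'' := by
  obtain ⟨K, L, hK, hinj, hX, hL, hE, hF⟩ := h
  refine ⟨fun t => K t * C t, fun t => (Y t).transpose * L t, ?_, ?_, ?_, ?_, ?_, ?_⟩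
  · intro i j
    simp only [Matrix.mul_apply]
    exact ContDiffOn.sum fun a _ => (hK i a).mul (hs.contDiffOn a j)
  · intro t ht
    rw [Matrix.mulVecLin_mul]
    exact (hinj t ht).comp (Matrix.mulVec_injective_iff.2 (hs.basis_obvious t ht).1)
  · intro t ht
    have hD := matrixDeriv_mulVec_mem hI hK hX ht
    rw [Matrix.mulVecLin_mul, LinearMap.range_comp, (hs.basis_obvious t ht).2, hE t ht, hF t ht]
    ext x
    constructor
    · rintro ⟨z, hz, rfl⟩
      exact (mem_obviousSpace_reduced hEZ hFZ (hX t ht) hD (hL t ht) z).1 hz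
    · intro hx
      obtain ⟨z, rfl⟩ := (hX t ht).symm ▸ hx.1
      exact ⟨z, (mem_obviousSpace_reduced hEZ hFZ (hX t ht) hD (hL t ht) z).2 hx, rfl⟩
  · intro t ht z hz h0
    refine hL t ht z (hEZ hz) (mulVec_transpose_injOn_range ?_ (by rwa [Matrix.mulVec_mulVec]))
    rw [(hs.basis_range t ht).2, hE t ht]
    exact (mem_range_reduced hEZ (hX t ht) (hL t ht) (hEZ hz)).2 hz
  · intro t ht
    rw [hs.left_eq t ht, hE t ht]
    simp only [Matrix.mul_assoc]
  · intro t ht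
    rw [hs.right_eq t ht, hE t ht, hF t ht, matrixDeriv_mul hI hK hs.contDiffOn ht]
    simp only [Matrix.mul_assoc, Matrix.mul_add, Matrix.add_mul, add_assoc]

theorem IsReducedTo.disjoint_ker (hne : I.Nonempty) (h : IsReducedTo I E F X Z E' F')
    (hE' : ∀ t ∈ I, IsUnit (E' t).det) : LinearMap.ker E.mulVecLin ⊓ X = ⊥ := by
  obtain ⟨K, L, hK, hinj, hX, hL, hE, hF⟩ := h
  obtain ⟨t, ht⟩ := hne
  rw [eq_bot_iff]
  rintro x ⟨hx, hxX⟩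
  obtain ⟨z, rfl⟩ := (hX t ht).symm ▸ hxX
  have hu : IsUnit (E' t) := (Matrix.isUnit_iff_isUnit_det _).2 (hE' t ht)
  have h0 : (E' t).mulVec z = 0 := by
    have hx' : E.mulVec ((K t).mulVec z) = 0 := hx
    rw [hE t ht, Matrix.mul_assoc, ← Matrix.mulVec_mulVec, ← Matrix.mulVec_mulVec, hx',
      Matrix.mulVec_zero]
  have hz : z = 0 := Matrix.mulVec_injective_of_isUnit hu (by rw [h0, Matrix.mulVec_zero])
  simp [hz]

/-- This replaces the last reduction step when the rank is `0`, a case in which regularity demands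
no such step. Then `E` vanishes on `X`, and pre-regularity alone makes `F'` surjective, hence
injective. -/
theorem IsReducedTo.next_eq_bot (hI : UniqueDiffOn ℝ I) (hne : I.Nonempty)
    (h : IsReducedTo I E F X Z E' F')
    (hEZ : X.map E.mulVecLin ≤ Z) {θ : ℕ} (hp : IsPreRegular I E' F' 0 θ) :
    X ⊓ (X.map E.mulVecLin).comap F.mulVecLin = ⊥ := by
  obtain ⟨K, L, hK, hinj, hX, hL, hE, hF⟩ := h
  obtain ⟨t, ht⟩ := hne
  have hE0 : E' t = 0 := by
    have := hp.rank_eq t ht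
    rw [Matrix.rank, Submodule.finrank_eq_zero, LinearMap.range_eq_bot] at this
    exact Matrix.toLin'.injective (by rw [Matrix.toLin'_apply', this, map_zero])
  have hker : ∀ x ∈ X, E.mulVec x = 0 := by
    intro x hx
    obtain ⟨z, rfl⟩ := (hX t ht).symm ▸ hx
    refine (mem_kerSpace_reduced hEZ (hX t ht) (hL t ht) z).1 ?_
    rw [← hE t ht, hE0]
    simp [kerSpace]
  have hmap : X.map E.mulVecLin = ⊥ := by
    rw [eq_bot_iff]
    rintro _ ⟨x, hx, rfl⟩
    exact hker x hx
  have hsurj : Function.Surjective (F' t).mulVecLin := by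
    intro y
    have hy : y ∈ LinearMap.range (Matrix.fromCols (E' t) (F' t)).mulVecLin := by
      rw [hp.range_eq_top t ht]; trivial
    obtain ⟨w, hw⟩ := hy
    refine ⟨w ∘ Sum.inr, ?_⟩
    rw [← hw, Matrix.mulVecLin_apply, Matrix.mulVecLin_apply, Matrix.fromCols_mulVec, hE0]
    simp
  have hinjF : Function.Injective (F' t).mulVecLin := LinearMap.injective_iff_surjective.2 hsurj
  have hD := matrixDeriv_mulVec_mem hI hK hX ht
  rw [hmap, eq_bot_iff]
  rintro x ⟨hx, hFx⟩
  obtain ⟨z, rfl⟩ := (hX t ht).symm ▸ hx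
  have h0 : (F' t).mulVecLin z = 0 := by
    have hx' : F.mulVec ((K t).mulVec z) = 0 := hFx
    rw [hF t ht, Matrix.mulVecLin_apply, ← Matrix.mulVec_mulVec, Matrix.add_mulVec,
      ← Matrix.mulVec_mulVec, ← Matrix.mulVec_mulVec, hx', hker _ (hD z), add_zero,
      Matrix.mulVec_zero]
  have hz : z = 0 := hinjF (by rw [h0, map_zero])
  simp [hz]

end

/-- The subspace containing the values of the pair at level `i` of the reduction. -/
def wongRange {V W : Type*} [AddCommGroup V] [Module ℝ V] [AddCommGroup W] [Module ℝ W]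
    (E F : V →ₗ[ℝ] W) : ℕ → Submodule ℝ W
  | 0 => ⊤
  | i + 1 => (wongSpace E F i).map E

theorem map_left_wongSpace_le {V W : Type*} [AddCommGroup V] [Module ℝ V] [AddCommGroup W]
    [Module ℝ W] (E F : V →ₗ[ℝ] W) : ∀ i, (wongSpace E F i).map E ≤ wongRange E F i
  | 0 => le_top
  | _ + 1 => Submodule.map_mono inf_le_left

theorem map_right_wongSpace_le {V W : Type*} [AddCommGroup V] [Module ℝ V] [AddCommGroup W]
    [Module ℝ W] (E F : V →ₗ[ℝ] W) : ∀ i, (wongSpace E F i).map F ≤ wongRange E F i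
  | 0 => le_top
  | _ + 1 => Submodule.map_le_iff_le_comap.2 inf_le_right

theorem isReducedTo_self (I : Set ℝ) {m : ℕ} (E F : Matrix (Fin m) (Fin m) ℝ) :
    IsReducedTo I E F ⊤ ⊤ (fun _ => E) (fun _ => F) := by
  refine ⟨fun _ => 1, fun _ => 1, fun i j => contDiffOn_const, ?_, ?_, ?_, ?_, ?_⟩
  · intro t _
    simpa using Function.injective_id
  · intro t _
    simp
  · intro t _ z _ h
    simpa using h
  · intro t _
    simp
  · intro t _
    have : matrixDeriv I (fun _ => (1 : Matrix (Fin m) (Fin m) ℝ)) t = 0 := by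
      ext i j
      simp [matrixDeriv]
    simp [this]

/-- The characteristic values of a constant regular pair in terms of its Wong sequence. -/
theorem IsRegular.wongSpace {I : Set ℝ} (hI : UniqueDiffOn ℝ I) (hne : I.Nonempty) {m : ℕ}
    {E F : Matrix (Fin m) (Fin m) ℝ} {μ : ℕ} {r θ : ℕ → ℕ}
    (h : IsRegular I (fun _ => E) (fun _ => F) μ r θ) :
    (∀ i ≤ μ, finrank ℝ (wongSpace E.mulVecLin F.mulVecLin i) = levelSize m r i) ∧
    (∀ i < μ, finrank ℝ (LinearMap.ker E.mulVecLin ⊓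
      DAE.wongSpace E.mulVecLin F.mulVecLin (i + 1) : Submodule ℝ (Fin m → ℝ)) = θ i) ∧
    LinearMap.ker E.mulVecLin ⊓ DAE.wongSpace E.mulVecLin F.mulVecLin μ = ⊥ := by
  obtain ⟨hμ, -, -, -, Es, Fs, Y, C, h0, h0', hpre, hstep, hlast⟩ := h
  obtain ⟨ν, rfl⟩ : ∃ ν, μ = ν + 1 := ⟨μ - 1, by omega⟩
  rw [Nat.add_sub_cancel] at hlast
  have hle := map_left_wongSpace_le E.mulVecLin F.mulVecLin
  have hle' := map_right_wongSpace_le E.mulVecLin F.mulVecLin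
  have hred : ∀ i, i ≤ ν → IsReducedTo I E F (DAE.wongSpace E.mulVecLin F.mulVecLin i)
      (wongRange E.mulVecLin F.mulVecLin i) (Es i) (Fs i) := by
    intro i
    induction i with
    | zero =>
      intro _
      rw [h0, h0']
      exact isReducedTo_self I E F
    | succ i ih =>
      intro hi
      exact (ih (by omega)).step hI (hle i) (hle' i) (hstep i (by omega))
  obtain ⟨t, ht⟩ := hne
  have hend : finrank ℝ (DAE.wongSpace E.mulVecLin F.mulVecLin (ν + 1)) = r ν ∧
      LinearMap.ker E.mulVecLin ⊓ DAE.wongSpace E.mulVecLin F.mulVecLin (ν + 1) = ⊥ := by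
    -- Level `μ` exists only for positive rank; for rank `0` the space `X μ` is itself zero.
    rcases Nat.eq_zero_or_pos (r ν) with hr | hr
    · have hp := hpre ν (by omega)
      rw [hr] at hp
      have hb : DAE.wongSpace E.mulVecLin F.mulVecLin (ν + 1) = ⊥ :=
        (hred ν le_rfl).next_eq_bot hI ⟨t, ht⟩ (hle ν) hp
      simp [hb, hr]
    · obtain ⟨hs, hdet⟩ := hlast hr
      have := (hred ν le_rfl).step hI (hle ν) (hle' ν) hs
      exact ⟨this.finrank_eq ⟨t, ht⟩, this.disjoint_ker ⟨t, ht⟩ hdet⟩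
  refine ⟨fun i hi => ?_, fun i hi => ?_, hend.2⟩
  · rcases Nat.lt_or_ge i (ν + 1) with h | h
    · exact (hred i (by omega)).finrank_eq ⟨t, ht⟩
    · obtain rfl : i = ν + 1 := by omega
      exact hend.1
  · rw [← (hpre i hi).finrank_eq t ht]
    exact (hred i (by omega)).finrank_ker_inf hI (hle i) (hle' i) ht

end DAE

/-! ### Regularity of the pencil and existence of the Weierstraß–Kronecker form -/

namespace DAE

open Module

/-- Since `F x = E (-c x)`, the line through `x` reproduces itself at each stage of the sequence. -/
theorem mem_wongSpace_of_pencil_apply_eq_zero {V W : Type*} [AddCommGroup V] [Module ℝ V]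
    [AddCommGroup W] [Module ℝ W] {E F : V →ₗ[ℝ] W} {c : ℝ} {x : V} (hx : c • E x + F x = 0) :
    ∀ i, x ∈ wongSpace E F i
  | 0 => trivial
  | i + 1 => by
    have h := mem_wongSpace_of_pencil_apply_eq_zero hx i
    refine ⟨h, -c • x, Submodule.smul_mem _ _ h, ?_⟩
    rw [map_smul, neg_smul, eq_comm]
    exact eq_neg_of_add_eq_zero_right hx

/-- With `G` a left inverse of `E` restricted to the Wong space, a nonzero vector with `F x = c • E
x` is an eigenvector of `G ∘ F` for `c`. Any `c` outside the finite spectrum works, with the sign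
reversed. -/
theorem exists_injective_pencil {V W : Type*} [AddCommGroup V] [Module ℝ V]
    [AddCommGroup W] [Module ℝ W] [FiniteDimensional ℝ V] {E F : V →ₗ[ℝ] W} {i : ℕ}
    (h : LinearMap.ker E ⊓ wongSpace E F i = ⊥) :
    ∃ c : ℝ, Function.Injective (c • E + F) := by
  have hk : LinearMap.ker (E.domRestrict (wongSpace E F i)) = ⊥ := by
    rw [LinearMap.ker_domRestrict, ← Submodule.disjoint_iff_comap_eq_bot, disjoint_iff, inf_comm, h]
  obtain ⟨G, hG⟩ := LinearMap.exists_leftInverse_of_injective _ hk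
  have hfin : {c : ℝ | Module.End.HasEigenvalue (G ∘ₗ F.domRestrict (wongSpace E F i)) c}.Finite :=
    Module.End.finite_hasEigenvalue _
  obtain ⟨c, hc⟩ := hfin.infinite_compl.nonempty
  refine ⟨-c, (injective_iff_map_eq_zero _).2 fun x hx => ?_⟩
  by_contra hx0
  have hxi := mem_wongSpace_of_pencil_apply_eq_zero (E := E) (F := F) (c := -c) (x := x) hx i
  refine hc (Module.End.hasEigenvalue_of_hasEigenvector (x := ⟨x, hxi⟩)
    ⟨Module.End.mem_eigenspace_iff.2 ?_, fun h0 => hx0 (congrArg Subtype.val h0)⟩)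
  have h1 : F x = c • E x := by
    have : -c • E x + F x = 0 := hx
    rw [neg_smul, neg_add_eq_zero] at this
    exact this.symm
  have h2 := LinearMap.congr_fun hG ⟨x, hxi⟩
  simp only [LinearMap.comp_apply, LinearMap.domRestrict_apply, LinearMap.id_apply] at h2 ⊢
  rw [h1, map_smul, h2]

theorem isRegularPencil_of_det_ne_zero {m : ℕ} {E F : Matrix (Fin m) (Fin m) ℝ} {c : ℝ}
    (h : (c • E + F).det ≠ 0) : IsRegularPencil E F := by
  intro h0
  apply h
  have := congrArg (Polynomial.evalRingHom c) h0
  rw [map_zero, RingHom.map_det] at this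
  rw [← this]
  congr 1
  ext i j
  simp [mul_comm (E i j)]

theorem exists_det_pencil_ne_zero {m : ℕ} {E F : Matrix (Fin m) (Fin m) ℝ} {i : ℕ}
    (h : LinearMap.ker E.mulVecLin ⊓ wongSpace E.mulVecLin F.mulVecLin i = ⊥) :
    ∃ c : ℝ, IsUnit (c • E + F).det := by
  obtain ⟨c, hc⟩ := exists_injective_pencil h
  refine ⟨c, (Matrix.isUnit_iff_isUnit_det _).1 (Matrix.mulVec_injective_iff_isUnit.1 ?_)⟩
  intro x y hxy
  apply hc
  simpa [Matrix.add_mulVec, Matrix.smul_mulVec] using hxy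

/-- Fitting's decomposition in matrix form. -/
theorem exists_fitting_matrix {m : ℕ} (T : Matrix (Fin m) (Fin m) ℝ) :
    ∃ (d n : ℕ) (_ : d + n = m) (A : Matrix (Fin d) (Fin d) ℝ) (B : Matrix (Fin n) (Fin n) ℝ)
      (K : Matrix (Fin m) (Fin d ⊕ Fin n) ℝ) (K' : Matrix (Fin d ⊕ Fin n) (Fin m) ℝ),
      IsUnit A ∧ IsNilpotent B ∧ K * K' = 1 ∧ K' * K = 1 ∧
        T * K = K * Matrix.fromBlocks A 0 0 B := by
  -- The condition `k ≥ 1` ensures `ker f ≤ ker (f ^ k)`, so that `f` is injective on the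
  -- complementary range.
  obtain ⟨k, hk, hk1⟩ := (T.mulVecLin.eventually_isCompl_ker_pow_range_pow.and
    (Filter.eventually_ge_atTop 1)).exists
  set f : Module.End ℝ (Fin m → ℝ) := T.mulVecLin with hf
  set U := LinearMap.range (f ^ k) with hU
  set V := LinearMap.ker (f ^ k) with hV
  have hcomm : ∀ x, (f ^ k) (f x) = f ((f ^ k) x) := fun x => by
    rw [← Module.End.mul_apply, ← Module.End.mul_apply, ← pow_succ, ← pow_succ']
  have hUf : ∀ x ∈ U, f x ∈ U := by
    rintro _ ⟨y, rfl⟩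
    exact ⟨f y, hcomm y⟩
  have hVf : ∀ x ∈ V, f x ∈ V := by
    intro x hx
    rw [hV, LinearMap.mem_ker] at hx ⊢
    rw [hcomm, hx, map_zero]
  have hc : IsCompl U V := hk.symm
  let φ := Submodule.prodEquivOfIsCompl U V hc
  let bU := finBasis ℝ U
  let bV := finBasis ℝ V
  let b := (bU.prod bV).map φ
  let s := Pi.basisFun ℝ (Fin m)
  let fU := f.restrict hUf
  let fV := f.restrict hVf
  have hfU : IsUnit fU := by
    rw [LinearMap.isUnit_iff_ker_eq_bot, LinearMap.ker_eq_bot']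
    rintro ⟨x, hx⟩ h0
    have h0' : f x = 0 := congrArg Subtype.val h0
    have hxV : x ∈ V := by
      rw [hV, LinearMap.mem_ker]
      obtain ⟨j, rfl⟩ : ∃ j, k = j + 1 := ⟨k - 1, by omega⟩
      rw [pow_succ, Module.End.mul_apply, h0', map_zero]
    exact Subtype.ext (Submodule.disjoint_def.1 hc.disjoint x hx hxV)
  have hfV : IsNilpotent fV := by
    refine ⟨k, ?_⟩
    ext x : 1
    apply Subtype.ext
    have : ∀ j, (((fV ^ j) x : V) : Fin m → ℝ) = (f ^ j) x := by
      intro j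
      induction j with
      | zero => rfl
      | succ j ih =>
        rw [pow_succ', pow_succ', Module.End.mul_apply, Module.End.mul_apply, ← ih]
        rfl
    rw [this]
    exact x.2
  have hdim : finrank ℝ U + finrank ℝ V = m := by
    have := Submodule.finrank_add_eq_of_isCompl hc
    simpa using this
  refine ⟨finrank ℝ U, finrank ℝ V, hdim, LinearMap.toMatrix bU bU fU, LinearMap.toMatrix bV bV fV,
    s.toMatrix b, b.toMatrix s, ?_, ?_, s.toMatrix_mul_toMatrix_flip b,
    b.toMatrix_mul_toMatrix_flip s, ?_⟩
  · exact hfU.map (LinearMap.toMatrixAlgEquiv bU)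
  · exact hfV.map (LinearMap.toMatrixAlgEquiv bV)
  · have h1 : LinearMap.toMatrix b b f = Matrix.fromBlocks (LinearMap.toMatrix bU bU fU) 0 0
        (LinearMap.toMatrix bV bV fV) := by
      rw [← LinearMap.toMatrix_prodMap bU bV fU fV]
      ext i j
      have h2 : f (b j) = φ (fU.prodMap fV ((bU.prod bV) j)) := by
        simp [b, φ, fU, fV]
      rw [LinearMap.toMatrix_apply, LinearMap.toMatrix_apply, h2]
      simp [b]
    have h3 : LinearMap.toMatrix s s f = T := by
      ext i j
      simp [s, hf]
    rw [← h1, ← h3, basis_toMatrix_mul_linearMap_toMatrix, linearMap_toMatrix_mul_basis_toMatrix]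

theorem isWeierstrassKroneckerForm_of_sum {m d n : ℕ} (h : d + n = m)
    {E F : Matrix (Fin m) (Fin m) ℝ} {W : Matrix (Fin d) (Fin d) ℝ} {N : Matrix (Fin n) (Fin n) ℝ}
    {L K' : Matrix (Fin d ⊕ Fin n) (Fin m) ℝ} {L' K : Matrix (Fin m) (Fin d ⊕ Fin n) ℝ}
    (hN : IsNilpotent N) (hL : L * L' = 1) (hK : K * K' = 1)
    (hE : L * E * K = Matrix.fromBlocks 1 0 0 N) (hF : L * F * K = Matrix.fromBlocks W 0 0 1) :
    IsWeierstrassKroneckerForm h E F W N := by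
  let e : Fin d ⊕ Fin n ≃ Fin m := finSumFinEquiv.trans (finCongr h)
  refine ⟨hN, L.submatrix e.symm id, K.submatrix id e.symm, ?_, ?_, ?_, ?_⟩
  · apply Matrix.isUnit_det_of_right_inverse (B := L'.submatrix id e.symm)
    have : L.submatrix e.symm id * L'.submatrix id e.symm = (L * L').submatrix e.symm e.symm := rfl
    rw [this, hL, Matrix.submatrix_one_equiv]
  · apply Matrix.isUnit_det_of_right_inverse (B := K'.submatrix e.symm id)
    rw [Matrix.submatrix_mul_equiv, hK, Matrix.submatrix_id_id]
  · rw [diagBlocks, ← hE]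
    rfl
  · rw [diagBlocks, ← hF]
    rfl

/-- With `P = c E + F` and `T = P⁻¹ E` one has `P⁻¹ F = 1 - c T`, so one Fitting basis
block-diagonalises both as `diag (A, B)` and `diag (1 - c A, 1 - c B)`. Multiplying on the left by
`diag (A⁻¹, (1 - c B)⁻¹)` normalises them. Nilpotency of `B` makes `1 - c B` invertible, and `(1 - c
B)⁻¹ B` is nilpotent because the factors commute. -/
theorem exists_isWeierstrassKroneckerForm {m : ℕ} {E F : Matrix (Fin m) (Fin m) ℝ} {c : ℝ}
    (h : IsUnit (c • E + F).det) :
    ∃ (d n : ℕ) (h : d + n = m) (W : Matrix (Fin d) (Fin d) ℝ) (N : Matrix (Fin n) (Fin n) ℝ),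
      IsWeierstrassKroneckerForm h E F W N := by
  set P := c • E + F with hP
  obtain ⟨d, n, hdn, A, B, K, K', hA, hB, hKK', hK'K, hT⟩ := exists_fitting_matrix (P⁻¹ * E)
  have hA' := (Matrix.isUnit_iff_isUnit_det A).1 hA
  have hQ : IsUnit (1 - c • B) :=
    ((hB.smul c).isUnit_one_sub)
  have hQ' := (Matrix.isUnit_iff_isUnit_det _).1 hQ
  set Q := 1 - c • B with hQdef
  have hQB : Commute B Q := by
    rw [hQdef]
    exact (Commute.one_right B).sub_right ((Commute.refl B).smul_right c)
  have hQB' : Commute B Q⁻¹ := by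
    rw [commute_iff_eq, ← Matrix.mul_one (Q⁻¹ * B), ← Matrix.mul_nonsing_inv Q hQ',
      ← Matrix.mul_assoc, Matrix.mul_assoc Q⁻¹ B Q, hQB.eq, ← Matrix.mul_assoc Q⁻¹ Q B,
      Matrix.nonsing_inv_mul Q hQ', Matrix.one_mul]
  let D := Matrix.fromBlocks A⁻¹ 0 0 Q⁻¹
  let D' := Matrix.fromBlocks A 0 0 Q
  have hAA := Matrix.nonsing_inv_mul A hA'
  have hQQ := Matrix.nonsing_inv_mul Q hQ'
  have hDD' : D * D' = 1 := by
    simp [D, D', Matrix.fromBlocks_multiply, hAA, hQQ]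
  have hE : P⁻¹ * E * K = K * Matrix.fromBlocks A 0 0 B := hT
  have hF : P⁻¹ * F * K = K * (1 - c • Matrix.fromBlocks A 0 0 B) := by
    have : F = P - c • E := by rw [hP]; abel
    rw [this, Matrix.mul_sub, Matrix.nonsing_inv_mul _ h, Matrix.sub_mul, Matrix.mul_smul,
      Matrix.smul_mul, hE, Matrix.mul_sub, Matrix.mul_smul]
    simp
  refine ⟨d, n, hdn, A⁻¹ * (1 - c • A), Q⁻¹ * B, isWeierstrassKroneckerForm_of_sum hdn
    (L := D * K' * P⁻¹) (L' := P * K * D') (K := K) (K' := K') ?_ ?_ hKK' ?_ ?_⟩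
  · exact hQB'.symm.isNilpotent_mul_left hB
  · calc D * K' * P⁻¹ * (P * K * D') = D * (K' * ((P⁻¹ * P) * K)) * D' := by
          simp only [Matrix.mul_assoc]
      _ = 1 := by rw [Matrix.nonsing_inv_mul _ h, Matrix.one_mul, hK'K, Matrix.mul_one, hDD']
  · calc D * K' * P⁻¹ * E * K = D * (K' * (P⁻¹ * E * K)) := by simp only [Matrix.mul_assoc]
      _ = Matrix.fromBlocks 1 0 0 (Q⁻¹ * B) := by
        rw [hE, ← Matrix.mul_assoc K', hK'K, Matrix.one_mul]
        simp [D, Matrix.fromBlocks_multiply, hAA]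
  · calc D * K' * P⁻¹ * F * K = D * (K' * (P⁻¹ * F * K)) := by simp only [Matrix.mul_assoc]
      _ = Matrix.fromBlocks (A⁻¹ * (1 - c • A)) 0 0 1 := by
        have h1 : 1 - c • Matrix.fromBlocks A 0 0 B = Matrix.fromBlocks (1 - c • A) 0 0 Q := by
          rw [← Matrix.fromBlocks_one, Matrix.fromBlocks_smul, sub_eq_add_neg,
            Matrix.fromBlocks_neg, Matrix.fromBlocks_add]
          simp [hQdef, sub_eq_add_neg]
        rw [hF, ← Matrix.mul_assoc K', hK'K, Matrix.one_mul, h1]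
        simp [D, Matrix.fromBlocks_multiply, hQQ]

end DAE

/-! ### The Wong sequence in Weierstraß–Kronecker coordinates -/

namespace DAE

open Module

section
variable {U V M M' : Type*} [AddCommGroup U] [Module ℝ U] [AddCommGroup V] [Module ℝ V]
  [AddCommGroup M] [Module ℝ M] [AddCommGroup M'] [Module ℝ M']
  {E F : M →ₗ[ℝ] M'} {W : U →ₗ[ℝ] U} {N : V →ₗ[ℝ] V} {Φ : (U × V) →ₗ[ℝ] M}
  {Ψ : (U × V) →ₗ[ℝ] M'}

/-- The Wong sequence of a pair in Weierstraß–Kronecker form. -/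
theorem wongSpace_of_decomposition (hΦ : Function.Surjective Φ) (hΨ : Function.Injective Ψ)
    (hE : ∀ u v, E (Φ (u, v)) = Ψ (u, N v)) (hF : ∀ u v, F (Φ (u, v)) = Ψ (W u, v)) (i : ℕ) :
    wongSpace E F i = ((⊤ : Submodule ℝ U).prod (LinearMap.range (N ^ i))).map Φ := by
  induction i with
  | zero =>
    rw [pow_zero, Module.End.one_eq_id, LinearMap.range_id, Submodule.prod_top, Submodule.map_top,
      LinearMap.range_eq_top.2 hΦ]
    rfl
  | succ i ih =>
    rw [wongSpace, ih]
    ext x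
    obtain ⟨⟨u, v⟩, rfl⟩ := hΦ x
    constructor
    · rintro ⟨-, x', ⟨⟨u', v'⟩, ⟨-, w, hw⟩, rfl⟩, hx'⟩
      rw [hE, hF] at hx'
      have h := congrArg Prod.snd (hΨ hx')
      refine Submodule.mem_map_of_mem ⟨trivial, w, ?_⟩
      rw [pow_succ', Module.End.mul_apply, hw]
      exact h
    · rintro ⟨⟨u', v'⟩, ⟨-, w, hw⟩, hx'⟩
      rw [← hx']
      have hw' : N ((N ^ i) w) = v' := by
        rw [← Module.End.mul_apply, ← pow_succ']
        exact hw
      refine ⟨Submodule.mem_map_of_mem ⟨trivial, N w, ?_⟩, ?_⟩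
      · rw [← Module.End.mul_apply, ← pow_succ]
        exact hw
      -- The `ℝᵈ` component imposes no condition, since `E` acts there as the identity; in the other
      -- component one factor `N` is removed.
      · exact ⟨Φ (W u', (N ^ i) w), Submodule.mem_map_of_mem ⟨trivial, w, rfl⟩,
          by rw [hE, hF, hw']⟩

/-- `Ψ (u, N v) = 0` forces `u = 0`, so the kernel lives in the nilpotent component alone. -/
theorem ker_inf_wongSpace_of_decomposition (hΦ : Function.Surjective Φ)
    (hΨ : Function.Injective Ψ) (hE : ∀ u v, E (Φ (u, v)) = Ψ (u, N v))
    (hF : ∀ u v, F (Φ (u, v)) = Ψ (W u, v)) (i : ℕ) :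
    LinearMap.ker E ⊓ wongSpace E F i =
      (LinearMap.ker N ⊓ LinearMap.range (N ^ i)).map (Φ ∘ₗ LinearMap.inr ℝ U V) := by
  rw [wongSpace_of_decomposition hΦ hΨ hE hF]
  ext x
  constructor
  · rintro ⟨hx, ⟨⟨u, v⟩, ⟨-, hv⟩, rfl⟩⟩
    rw [SetLike.mem_coe, LinearMap.mem_ker, hE] at hx
    have h := hΨ (hx.trans (map_zero Ψ).symm)
    rw [Prod.mk_eq_zero] at h
    exact ⟨v, ⟨h.2, hv⟩, by rw [h.1]; rfl⟩
  · rintro ⟨v, ⟨hv, hv'⟩, rfl⟩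
    refine ⟨?_, Submodule.mem_map_of_mem (f := Φ) ⟨trivial, hv'⟩⟩
    have h : E (Φ (0, v)) = Ψ (0, N v) := hE 0 v
    rw [LinearMap.mem_ker.1 hv, ← Prod.zero_eq_mk, map_zero] at h
    exact h

end

theorem diagBlocks_mulVec {m d n : ℕ} (h : d + n = m) (A : Matrix (Fin d) (Fin d) ℝ)
    (B : Matrix (Fin n) (Fin n) ℝ) (u : Fin d → ℝ) (v : Fin n → ℝ) :
    (diagBlocks h A B).mulVec (Sum.elim u v ∘ (finSumFinEquiv.trans (finCongr h)).symm) =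
      Sum.elim (A.mulVec u) (B.mulVec v) ∘ (finSumFinEquiv.trans (finCongr h)).symm := by
  rw [diagBlocks, Matrix.reindex_apply, Matrix.submatrix_mulVec_equiv, Matrix.fromBlocks_mulVec]
  have h1 : (Sum.elim u v ∘ (finSumFinEquiv.trans (finCongr h)).symm) ∘
      (finSumFinEquiv.trans (finCongr h)).symm.symm = Sum.elim u v := by
    rw [Function.comp_assoc, Equiv.symm_symm, Equiv.symm_comp_self, Function.comp_id]
  rw [h1]
  simp

/-- `Φ` is `K` and `Ψ` is `L⁻¹`, each read on the split coordinates. -/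
theorem IsWeierstrassKroneckerForm.exists_decomposition {m d n : ℕ} {h : d + n = m}
    {E F : Matrix (Fin m) (Fin m) ℝ} {W : Matrix (Fin d) (Fin d) ℝ} {N : Matrix (Fin n) (Fin n) ℝ}
    (hWK : IsWeierstrassKroneckerForm h E F W N) :
    ∃ Φ Ψ : ((Fin d → ℝ) × (Fin n → ℝ)) →ₗ[ℝ] (Fin m → ℝ),
      Function.Bijective Φ ∧ Function.Injective Ψ ∧
      (∀ u v, E.mulVecLin (Φ (u, v)) = Ψ (u, N.mulVecLin v)) ∧
      (∀ u v, F.mulVecLin (Φ (u, v)) = Ψ (W.mulVecLin u, v)) := by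
  obtain ⟨-, L, K, hL, hK, hE, hF⟩ := hWK
  let σ : ((Fin d → ℝ) × (Fin n → ℝ)) ≃ₗ[ℝ] (Fin m → ℝ) :=
    (LinearEquiv.sumArrowLequivProdArrow (Fin d) (Fin n) ℝ ℝ).symm ≪≫ₗ
      LinearEquiv.funCongrLeft ℝ ℝ (finSumFinEquiv.trans (finCongr h)).symm
  have hσ : ∀ u v, σ (u, v) = Sum.elim u v ∘ (finSumFinEquiv.trans (finCongr h)).symm := by
    intro u v
    rfl
  have hLL := Matrix.nonsing_inv_mul L hL
  have hE' : E * K = L⁻¹ * diagBlocks h 1 N := by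
    rw [← hE, ← Matrix.mul_assoc, ← Matrix.mul_assoc, hLL, Matrix.one_mul]
  have hF' : F * K = L⁻¹ * diagBlocks h W 1 := by
    rw [← hF, ← Matrix.mul_assoc, ← Matrix.mul_assoc, hLL, Matrix.one_mul]
  have hK' : IsUnit K := (Matrix.isUnit_iff_isUnit_det K).2 hK
  have hL' : IsUnit L⁻¹ := by
    rw [Matrix.isUnit_nonsing_inv_iff]
    exact (Matrix.isUnit_iff_isUnit_det L).2 hL
  refine ⟨K.mulVecLin ∘ₗ σ.toLinearMap, L⁻¹.mulVecLin ∘ₗ σ.toLinearMap, ⟨?_, ?_⟩, ?_, ?_, ?_⟩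
  · exact (Matrix.mulVec_injective_of_isUnit hK').comp σ.injective
  · exact (Matrix.mulVec_surjective_iff_isUnit.2 hK').comp σ.surjective
  · exact (Matrix.mulVec_injective_of_isUnit hL').comp σ.injective
  · intro u v
    simp only [LinearMap.comp_apply, LinearEquiv.coe_coe, Matrix.mulVecLin_apply, hσ]
    rw [Matrix.mulVec_mulVec, hE', ← Matrix.mulVec_mulVec, diagBlocks_mulVec, Matrix.one_mulVec]
  · intro u v
    simp only [LinearMap.comp_apply, LinearEquiv.coe_coe, Matrix.mulVecLin_apply, hσ]
    rw [Matrix.mulVec_mulVec, hF', ← Matrix.mulVec_mulVec, diagBlocks_mulVec, Matrix.one_mulVec]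

theorem mulVecLin_pow {n : ℕ} (N : Matrix (Fin n) (Fin n) ℝ) (i : ℕ) :
    N.mulVecLin ^ i = (N ^ i).mulVecLin := by
  rw [← Matrix.toLin'_apply', ← Matrix.toLin'_apply', Matrix.toLin'_pow]

theorem mulVecLin_eq_zero {n : ℕ} {N : Matrix (Fin n) (Fin n) ℝ} : N.mulVecLin = 0 ↔ N = 0 := by
  rw [← Matrix.toLin'_apply', LinearEquiv.map_eq_zero_iff]

/-- If `N ^ (i + k + 1) = 0`, the image of `N ^ (i + k)` lies in `ker N ∩ im Nⁱ`, hence is zero. The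
exponent thus descends to `i`. -/
theorem pow_eq_zero_of_ker_inf_range_pow {n : ℕ} {N : Matrix (Fin n) (Fin n) ℝ}
    (hN : IsNilpotent N) {i : ℕ}
    (h : LinearMap.ker N.mulVecLin ⊓ LinearMap.range (N.mulVecLin ^ i) = ⊥) : N ^ i = 0 := by
  obtain ⟨k, hk⟩ := hN
  have hk' : N ^ (i + k) = 0 := by rw [pow_add, hk, mul_zero]
  clear hk
  induction k with
  | zero => exact hk'
  | succ k ih =>
    apply ih
    rw [← mulVecLin_eq_zero]
    refine LinearMap.ext fun v => ?_
    rw [← mulVecLin_pow]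
    have hv : (N.mulVecLin ^ (i + k)) v ∈ LinearMap.ker N.mulVecLin ⊓
        LinearMap.range (N.mulVecLin ^ i) := by
      refine ⟨?_, (N.mulVecLin ^ k) v, by rw [pow_add, Module.End.mul_apply]⟩
      rw [SetLike.mem_coe, LinearMap.mem_ker, ← Module.End.mul_apply, ← pow_succ', mulVecLin_pow, add_assoc, hk',
        Matrix.mulVecLin_zero, LinearMap.zero_apply]
    rw [h] at hv
    exact hv

end DAE

/-! ### Counting Jordan blocks by `ker N ∩ im Nʲ` -/

namespace DAE

open Module

section
variable {ι : Type*} (k : ι → ℕ)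

/-- The block diagonal matrix of nilpotent Jordan blocks as an endomorphism. -/
def jordanShift : ((Σ a, Fin (k a)) → ℝ) →ₗ[ℝ] ((Σ a, Fin (k a)) → ℝ) where
  toFun v p := if h : (p.2 : ℕ) + 1 < k p.1 then v ⟨p.1, ⟨p.2 + 1, h⟩⟩ else 0
  map_add' v w := by
    ext p
    by_cases h : (p.2 : ℕ) + 1 < k p.1 <;> simp [h]
  map_smul' c v := by
    ext p
    by_cases h : (p.2 : ℕ) + 1 < k p.1 <;> simp [h]

theorem jordanShift_apply (v : (Σ a, Fin (k a)) → ℝ) (a : ι) (b : Fin (k a)) :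
    jordanShift k v ⟨a, b⟩ = if h : (b : ℕ) + 1 < k a then v ⟨a, ⟨b + 1, h⟩⟩ else 0 := rfl

theorem blockDiagonal'_mulVec_eq_jordanShift [Fintype ι] [DecidableEq ι] (v : (Σ a, Fin (k a)) → ℝ) :
    (Matrix.blockDiagonal' fun a => nilpotentJordanBlock (k a)).mulVec v = jordanShift k v := by
  ext ⟨a, b⟩
  rw [jordanShift_apply, Matrix.mulVec, dotProduct, Fintype.sum_sigma,
    Finset.sum_eq_single a]
  · simp only [Matrix.blockDiagonal'_apply_eq, nilpotentJordanBlock, Matrix.of_apply, ite_mul,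
      one_mul, zero_mul]
    split_ifs with h
    · rw [Finset.sum_eq_single ⟨(b : ℕ) + 1, h⟩]
      · simp
      · intro c _ hc
        rw [if_neg]
        intro hbc
        exact hc (Fin.ext hbc.symm)
      · simp
    · apply Finset.sum_eq_zero
      intro c _
      rw [if_neg]
      have := c.2
      omega
  · intro a' _ ha'
    apply Finset.sum_eq_zero
    intro c _
    rw [Matrix.blockDiagonal'_apply_ne _ _ _ ha'.symm, zero_mul]
  · simp

theorem jordanShift_pow_apply (j : ℕ) (v : (Σ a, Fin (k a)) → ℝ) (a : ι) (b : Fin (k a)) :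
    (jordanShift k ^ j) v ⟨a, b⟩ = if h : (b : ℕ) + j < k a then v ⟨a, ⟨b + j, h⟩⟩ else 0 := by
  induction j generalizing v with
  | zero => simp
  | succ j ih =>
    rw [pow_succ, Module.End.mul_apply, ih]
    by_cases h : (b : ℕ) + j < k a
    · rw [dif_pos h, jordanShift_apply]
      rfl
    · rw [dif_neg h, dif_neg (by omega)]

/-- The kernel of the shift is spanned by the first unit vector of each block. That vector is
reached by the `j`-th power exactly when the block has a position `j`, so the intersection is the
space of functions on the first positions of blocks of order at least `j + 1`. -/
theorem finrank_ker_inf_range_jordanShift_pow [Fintype ι] (j : ℕ) :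
    finrank ℝ (LinearMap.ker (jordanShift k) ⊓ LinearMap.range (jordanShift k ^ j) :
      Submodule ℝ ((Σ a, Fin (k a)) → ℝ)) = (Finset.univ.filter fun a => j + 1 ≤ k a).card := by
  let s : {a // j + 1 ≤ k a} → Σ a, Fin (k a) := fun a => ⟨a.1, ⟨0, by have := a.2; omega⟩⟩
  have hs : Function.Injective s := fun a b hab => Subtype.ext (congrArg Sigma.fst hab)
  let f := Function.ExtendByZero.linearMap ℝ s
  have hf : Function.Injective f := fun v w hvw => by
    ext a
    have := congrFun hvw (s a)
    simpa [f, hs.extend_apply] using this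
  have hrange : LinearMap.ker (jordanShift k) ⊓ LinearMap.range (jordanShift k ^ j)
      = LinearMap.range f := by
    ext x
    constructor
    · rintro ⟨hx, y, rfl⟩
      refine ⟨fun a => (jordanShift k ^ j) y (s a), ?_⟩
      ext ⟨a, b⟩
      change Function.extend s (fun a => (jordanShift k ^ j) y (s a))
        (0 : (Σ a, Fin (k a)) → ℝ) ⟨a, b⟩ = (jordanShift k ^ j) y ⟨a, b⟩
      by_cases hp : ∃ a', s a' = ⟨a, b⟩
      · obtain ⟨a', ha'⟩ := hp
        rw [← ha', hs.extend_apply]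
      · rw [Function.extend_apply' _ _ _ hp, Pi.zero_apply]
        -- At `b = 0` the block is too short for the `j`-th shift to reach; at `b > 0` the kernel
        -- equation at position `b - 1` says that the entry vanishes.
        rcases Nat.eq_zero_or_pos (b : ℕ) with hb | hb
        · rw [jordanShift_pow_apply, dif_neg]
          intro hlt
          refine hp ⟨⟨a, by omega⟩, ?_⟩
          simp only [s, Sigma.mk.injEq, heq_eq_eq, true_and]
          exact Fin.ext hb.symm
        · have h := congrFun hx ⟨a, ⟨b - 1, by omega⟩⟩
          rw [jordanShift_apply, dif_pos (by have := b.2; simp only; omega)] at h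
          have hb' : (⟨(b : ℕ) - 1 + 1, by omega⟩ : Fin (k a)) = b :=
            Fin.ext (Nat.sub_add_cancel hb)
          simp only [hb'] at h
          exact h.symm
    · rintro ⟨w, rfl⟩
      have hw : ∀ a b, f w ⟨a, b⟩ =
          if h : (b : ℕ) = 0 ∧ j + 1 ≤ k a then w ⟨a, h.2⟩ else 0 := by
        intro a b
        change Function.extend s w 0 _ = _
        split_ifs with h
        · have : (⟨a, b⟩ : Σ a, Fin (k a)) = s ⟨a, h.2⟩ := by
            simp only [s, Sigma.mk.injEq, heq_eq_eq, true_and]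
            exact Fin.ext h.1
          rw [this, hs.extend_apply]
        · rw [Function.extend_apply', Pi.zero_apply]
          rintro ⟨a', ha'⟩
          obtain rfl : a'.1 = a := congrArg Sigma.fst ha'
          simp only [s, Sigma.mk.injEq, heq_eq_eq, true_and] at ha'
          exact h ⟨by rw [← ha'], a'.2⟩
      -- The preimage carries the values of `w` at position `j`, which `j` shifts bring to position
      -- `0`.
      refine ⟨?_, fun p => if h : (p.2 : ℕ) = j then w ⟨p.1, by have := p.2.2; omega⟩ else 0, ?_⟩
      · rw [SetLike.mem_coe, LinearMap.mem_ker]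
        ext ⟨a, b⟩
        rw [jordanShift_apply, Pi.zero_apply]
        split_ifs with h
        · rw [hw, dif_neg (by simp)]
        · rfl
      · ext ⟨a, b⟩
        rw [jordanShift_pow_apply, hw]
        by_cases hb : (b : ℕ) = 0
        · by_cases hj : j + 1 ≤ k a
          · have hbj : (b : ℕ) + j < k a := by omega
            have hb' : (b : ℕ) + j = j := by omega
            rw [dif_pos hbj, dif_pos (And.intro hb hj), dif_pos hb']
          · have hbj : ¬(b : ℕ) + j < k a := by omega
            have hb' : ¬((b : ℕ) = 0 ∧ j + 1 ≤ k a) := fun h => hj h.2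
            rw [dif_neg hbj, dif_neg hb']
        · rw [dif_neg (by tauto : ¬((b : ℕ) = 0 ∧ j + 1 ≤ k a))]
          split_ifs with h1 h2
          · simp only at h2
            omega
          · rfl
          · rfl
  rw [hrange, LinearMap.finrank_range_of_inj hf, Module.finrank_fintype_fun_eq_card,
    Fintype.card_subtype]

end

theorem HasNilpotentJordanForm.finrank_ker_inf_range_pow {n s : ℕ}
    {N : Matrix (Fin n) (Fin n) ℝ} {k : Fin s → ℕ} (h : HasNilpotentJordanForm N k) (j : ℕ) :
    finrank ℝ (LinearMap.ker N.mulVecLin ⊓ LinearMap.range (N.mulVecLin ^ j) :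
      Submodule ℝ (Fin n → ℝ)) = (Finset.univ.filter fun a => j + 1 ≤ k a).card := by
  obtain ⟨-, e, P, hP, hNP⟩ := h
  have hP' : IsUnit P := (Matrix.isUnit_iff_isUnit_det P).2 hP
  let ψ : ((Σ a, Fin (k a)) → ℝ) →ₗ[ℝ] (Fin n → ℝ) :=
    P.mulVecLin ∘ₗ (LinearEquiv.funCongrLeft ℝ ℝ e.symm).toLinearMap
  have hψ : ∀ v, ψ v = P.mulVec (v ∘ e.symm) := fun v => rfl
  have hinj : Function.Injective ψ :=
    (Matrix.mulVec_injective_of_isUnit hP').comp (LinearEquiv.injective _)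
  have hsurj : Function.Surjective ψ :=
    (Matrix.mulVec_surjective_iff_isUnit.2 hP').comp (LinearEquiv.surjective _)
  have hint : ∀ v, N.mulVecLin (ψ v) = ψ (jordanShift k v) := by
    intro v
    rw [hψ, hψ, Matrix.mulVecLin_apply, Matrix.mulVec_mulVec, hNP, ← Matrix.mulVec_mulVec,
      Matrix.reindex_apply, Matrix.submatrix_mulVec_equiv, Equiv.symm_symm, Function.comp_assoc,
      Equiv.symm_comp_self, Function.comp_id, blockDiagonal'_mulVec_eq_jordanShift]
  have hint' : ∀ j v, (N.mulVecLin ^ j) (ψ v) = ψ ((jordanShift k ^ j) v) := by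
    intro j
    induction j with
    | zero => intro v; rfl
    | succ j ih =>
      intro v
      rw [pow_succ, pow_succ, Module.End.mul_apply, Module.End.mul_apply, hint, ih]
  have hmap : LinearMap.ker N.mulVecLin ⊓ LinearMap.range (N.mulVecLin ^ j) =
      (LinearMap.ker (jordanShift k) ⊓ LinearMap.range (jordanShift k ^ j)).map ψ := by
    ext x
    constructor
    · rintro ⟨hx, y, rfl⟩
      obtain ⟨v, rfl⟩ := hsurj y
      rw [hint'] at hx ⊢
      refine Submodule.mem_map_of_mem ⟨?_, v, rfl⟩
      rw [SetLike.mem_coe, LinearMap.mem_ker, hint] at hx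
      exact hinj (by rw [hx, map_zero])
    · rintro ⟨x, ⟨hx, v, rfl⟩, rfl⟩
      refine ⟨?_, ψ v, hint' j v⟩
      rw [SetLike.mem_coe, LinearMap.mem_ker, hint, LinearMap.mem_ker.1 hx, map_zero]
  rw [hmap, ← (Submodule.equivMapOfInjective ψ hinj _).finrank_eq,
    finrank_ker_inf_range_jordanShift_pow]

end DAE

/-! ### Existence of the nilpotent Jordan form -/

namespace DAE

open Module Polynomial

/-- The powers run downwards so that multiplication by `X` lowers the index, as the superdiagonal
ones of `nilpotentJordanBlock` require. -/
theorem exists_basis_adjoinRoot_X_pow (k : ℕ) :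
    ∃ b : Basis (Fin k) ℝ (AdjoinRoot ((X : ℝ[X]) ^ k)),
      ∀ i, b i = AdjoinRoot.root ((X : ℝ[X]) ^ k) ^ (k - 1 - (i : ℕ)) := by
  have hg : ((X : ℝ[X]) ^ k).Monic := monic_X_pow k
  have hdeg : (AdjoinRoot.powerBasis' hg).dim = k := natDegree_X_pow k
  refine ⟨(AdjoinRoot.powerBasis' hg).basis.reindex ((finCongr hdeg).trans Fin.revPerm),
    fun i => ?_⟩
  rw [Basis.reindex_apply, PowerBasis.basis_eq_pow, AdjoinRoot.powerBasis'_gen]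
  congr 1
  change k - ((i : ℕ) + 1) = k - 1 - i
  omega

/-- The basis `X ^ (k - 1), …, X, 1` of `ℝ[X] / (X ^ k)`. -/
theorem exists_basis_quotient_X_pow (k : ℕ) :
    ∃ b : Basis (Fin k) ℝ (ℝ[X] ⧸ (Submodule.span ℝ[X] {(X : ℝ[X]) ^ k})),
      ∀ i, b i = Submodule.Quotient.mk (X ^ (k - 1 - (i : ℕ))) := by
  obtain ⟨b, hb⟩ := exists_basis_adjoinRoot_X_pow k
  have hb' : ∀ i, b i = AdjoinRoot.mk ((X : ℝ[X]) ^ k) (X ^ (k - 1 - (i : ℕ))) := by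
    intro i
    rw [hb, AdjoinRoot.root, ← map_pow]
  exact ⟨b, hb'⟩

theorem dfinsupp_basis_apply {ι R : Type*} [DecidableEq ι] {η M : ι → Type*} [Semiring R]
    [∀ i, AddCommMonoid (M i)] [∀ i, Module R (M i)] (b : ∀ i, Basis (η i) R (M i)) (a : ι)
    (c : η a) : DFinsupp.basis b ⟨a, c⟩ = DFinsupp.single a (b a c) := by
  rw [Basis.apply_eq_iff]
  change (sigmaFinsuppLequivDFinsupp R).symm
    (DFinsupp.mapRange.linearEquiv (fun i => (b i).repr) _) = _
  rw [LinearEquiv.symm_apply_eq]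
  simp

/-- With `X` acting as `N`, the space is an `X`-power torsion `ℝ[X]`-module, so it is a finite
direct sum of modules `ℝ[X] / (X ^ k a)`; their monomial bases together form a Jordan basis. -/
theorem exists_jordan_basis {n : ℕ} {N : Matrix (Fin n) (Fin n) ℝ} (hN : IsNilpotent N) :
    ∃ (s : ℕ) (k : Fin s → ℕ) (v : Basis (Σ a, Fin (k a)) ℝ (Fin n → ℝ)),
      ∀ a b, N.mulVec (v ⟨a, b⟩) =
        if h : 0 < (b : ℕ) then v ⟨a, ⟨b - 1, by omega⟩⟩ else 0 := by
  obtain ⟨c, hc⟩ := hN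
  let f : Module.End ℝ (Fin n → ℝ) := N.mulVecLin
  have hf : f ^ c = 0 := by rw [mulVecLin_pow, hc, Matrix.mulVecLin_zero]
  have htor : Module.IsTorsion' (AEval' f) (Submonoid.powers (X : ℝ[X])) := by
    intro x
    refine ⟨⟨X ^ c, c, rfl⟩, ?_⟩
    obtain ⟨y, rfl⟩ := (AEval'.of f).surjective x
    change (X ^ c : ℝ[X]) • AEval'.of f y = 0
    rw [AEval'.X_pow_smul_of, hf]
    simp
  obtain ⟨s, k, ⟨e⟩⟩ := Module.torsion_by_prime_power_decomposition (irreducible_X (R := ℝ)) htor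
  choose b hb using exists_basis_quotient_X_pow
  let B : Basis (Σ a, Fin (k a)) ℝ
      (DirectSum (Fin s) fun a => ℝ[X] ⧸ Submodule.span ℝ[X] {(X : ℝ[X]) ^ k a}) :=
    DFinsupp.basis fun a => b (k a)
  have hB : ∀ a c, B ⟨a, c⟩ = DirectSum.lof ℝ[X] _ _ a (b (k a) c) := by
    intro a c
    exact dfinsupp_basis_apply (fun a => b (k a)) a c
  have hX : ∀ a c, (X : ℝ[X]) • B ⟨a, c⟩ =
      if h : 0 < (c : ℕ) then B ⟨a, ⟨c - 1, by omega⟩⟩ else 0 := by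
    intro a c
    rw [hB, ← map_smul, hb, ← Submodule.Quotient.mk_smul, smul_eq_mul, ← pow_succ']
    have := c.2
    split_ifs with h
    · rw [hB, hb]
      congr 3
      simp only
      omega
    · rw [(Submodule.Quotient.mk_eq_zero _).2, map_zero]
      rw [show k a - 1 - (c : ℕ) + 1 = k a by omega]
      exact Submodule.mem_span_singleton_self _
  let g := (AEval'.of f).trans (e.restrictScalars ℝ)
  refine ⟨s, k, B.map g.symm, fun a c => ?_⟩
  have hg : ∀ y, N.mulVec (g.symm y) = g.symm ((X : ℝ[X]) • y) := by
    intro y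
    rw [LinearEquiv.eq_symm_apply]
    change e (AEval'.of f (f (g.symm y))) = _
    rw [← AEval'.X_smul_of, map_smul]
    congr 1
    exact g.apply_symm_apply y
  rw [Basis.map_apply, hg, hX]
  split_ifs with h
  · rw [Basis.map_apply]
  · rw [map_zero]

theorem exists_hasNilpotentJordanForm {n : ℕ} {N : Matrix (Fin n) (Fin n) ℝ}
    (hN : IsNilpotent N) : ∃ (s : ℕ) (k : Fin s → ℕ), HasNilpotentJordanForm N k := by
  obtain ⟨s, k, v, hv⟩ := exists_jordan_basis hN
  -- The decomposition may contain zero summands with `k a = 0`; these are discarded, which leaves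
  -- the basis unchanged up to reindexing.
  let q := Fintype.equivFin {a // 1 ≤ k a}
  let k' : Fin (Fintype.card {a // 1 ≤ k a}) → ℕ := fun a => k (q.symm a)
  let τ : (Σ a, Fin (k' a)) ≃ Σ a, Fin (k a) :=
    Equiv.ofBijective (fun p => ⟨(q.symm p.1).1, p.2⟩) (by
      constructor
      · rintro ⟨a, b⟩ ⟨a', b'⟩ h
        obtain ⟨h1, h2⟩ := Sigma.mk.inj h
        obtain rfl : a = a' := q.symm.injective (Subtype.ext h1)
        exact congrArg (Sigma.mk a) (eq_of_heq h2)
      · rintro ⟨a, b⟩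
        have hk : 1 ≤ k a := by have := b.2; omega
        obtain ⟨a', ha'⟩ := q.symm.surjective ⟨a, hk⟩
        have ha'' : (q.symm a').1 = a := by rw [ha']
        subst ha''
        exact ⟨⟨a', b⟩, rfl⟩)
  let w : Basis (Σ a, Fin (k' a)) ℝ (Fin n → ℝ) := v.reindex τ.symm
  have hw : ∀ a b, N.mulVec (w ⟨a, b⟩) =
      if h : 0 < (b : ℕ) then w ⟨a, ⟨b - 1, by omega⟩⟩ else 0 := by
    intro a b
    have h := hv (q.symm a).1 b
    simp only [w, Basis.reindex_apply, Equiv.symm_symm]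
    exact h
  have hcard : Fintype.card (Σ a, Fin (k' a)) = Fintype.card (Fin n) := by
    rw [← finrank_eq_card_basis w, finrank_fintype_fun_eq_card]
  let e := Fintype.equivOfCardEq hcard
  refine ⟨_, k', fun a => (q.symm a).2, e, (Pi.basisFun ℝ (Fin n)).toMatrix (w.reindex e), ?_, ?_⟩
  · exact Matrix.isUnit_det_of_right_inverse
      ((Pi.basisFun ℝ (Fin n)).toMatrix_mul_toMatrix_flip (w.reindex e))
  · ext i j
    obtain ⟨⟨a, b⟩, rfl⟩ := e.surjective j
    have h1 : (N * (Pi.basisFun ℝ (Fin n)).toMatrix (w.reindex e)) i (e ⟨a, b⟩)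
        = N.mulVec (w ⟨a, b⟩) i := by
      simp [Matrix.mul_apply, Matrix.mulVec, dotProduct, Basis.toMatrix_apply]
    rw [h1, hw, Matrix.mul_apply, ← e.sum_comp, Fintype.sum_sigma, Finset.sum_eq_single a]
    · simp only [Matrix.reindex_apply, Matrix.submatrix_apply, Equiv.symm_apply_apply,
        Matrix.blockDiagonal'_apply_eq, nilpotentJordanBlock, Matrix.of_apply, mul_ite, mul_one,
        mul_zero, Basis.toMatrix_apply, Basis.reindex_apply, Pi.basisFun_repr]
      split_ifs with h
      · rw [Finset.sum_eq_single ⟨(b : ℕ) - 1, by omega⟩]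
        · rw [if_pos (by simp only; omega)]
        · intro c _ hc
          rw [if_neg]
          intro hcb
          exact hc (Fin.ext (by simp only; omega))
        · simp
      · symm
        apply Finset.sum_eq_zero
        intro c _
        rw [if_neg (by omega)]
    · intro a' _ ha'
      apply Finset.sum_eq_zero
      intro c _
      simp only [Matrix.reindex_apply, Matrix.submatrix_apply, Equiv.symm_apply_apply]
      rw [Matrix.blockDiagonal'_apply_ne _ _ _ ha', mul_zero]
    · simp

end DAE

/-! ### Assembly of the theorem -/

theorem DAE.uniqueDiffOn_of_ordConnected {I : Set ℝ} (hI : I.OrdConnected) (hI' : I.Nontrivial) :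
    UniqueDiffOn ℝ I := by
  obtain ⟨a, ha, b, hb, hab⟩ := hI'.exists_lt
  refine uniqueDiffOn_convex hI.convex ⟨(a + b) / 2, ?_⟩
  rw [mem_interior]
  exact ⟨Set.Ioo a b, Set.Ioo_subset_Icc_self.trans (hI.out ha hb), isOpen_Ioo,
    by constructor <;> linarith⟩

theorem corollary4p4 {m : ℕ} (E F : Matrix (Fin m) (Fin m) ℝ)
    (I : Set ℝ) (hI : I.OrdConnected) (hI' : I.Nontrivial)
    (μ : ℕ) (r θ : ℕ → ℕ)
    (hreg : DAE.IsRegular I (fun _ => E) (fun _ => F) μ r θ) :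
    DAE.IsRegularPencil E F ∧
    (∃ (d n : ℕ) (h : d + n = m) (W : Matrix (Fin d) (Fin d) ℝ) (N : Matrix (Fin n) (Fin n) ℝ),
      DAE.IsWeierstrassKroneckerForm h E F W N) ∧
    ∀ (d n : ℕ) (h : d + n = m) (W : Matrix (Fin d) (Fin d) ℝ) (N : Matrix (Fin n) (Fin n) ℝ),
      DAE.IsWeierstrassKroneckerForm h E F W N →
        nilpotencyClass N = μ ∧
        (∃ (s : ℕ) (k : Fin s → ℕ), DAE.HasNilpotentJordanForm N k) ∧
        ∀ (s : ℕ) (k : Fin s → ℕ), DAE.HasNilpotentJordanForm N k →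
          ∀ i, i + 2 ≤ μ → θ i = (Finset.univ.filter fun a : Fin s => i + 2 ≤ k a).card := by
  obtain ⟨hdim, hθ, hμ⟩ :=
    hreg.wongSpace (DAE.uniqueDiffOn_of_ordConnected hI hI') hI'.nonempty
  obtain ⟨h1, hr0, hr, -⟩ := hreg
  obtain ⟨c, hc⟩ := DAE.exists_det_pencil_ne_zero hμ
  refine ⟨DAE.isRegularPencil_of_det_ne_zero hc.ne_zero,
    DAE.exists_isWeierstrassKroneckerForm hc, fun d n h W N hWK => ?_⟩
  obtain ⟨Φ, Ψ, hΦ, hΨ, hE, hF⟩ := hWK.exists_decomposition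
  have hinj : Function.Injective (Φ ∘ₗ LinearMap.inr ℝ (Fin d → ℝ) (Fin n → ℝ)) :=
    hΦ.1.comp LinearMap.inr_injective
  have hX := DAE.wongSpace_of_decomposition hΦ.2 hΨ hE hF
  have hker := DAE.ker_inf_wongSpace_of_decomposition hΦ.2 hΨ hE hF
  have hNμ : N ^ μ = 0 := by
    refine DAE.pow_eq_zero_of_ker_inf_range_pow hWK.1 ?_
    rw [hker, ← Submodule.map_bot (Φ ∘ₗ LinearMap.inr ℝ (Fin d → ℝ) (Fin n → ℝ))] at hμ
    exact Submodule.map_injective_of_injective hinj hμ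
  obtain ⟨ν, rfl⟩ : ∃ ν, μ = ν + 1 := ⟨μ - 1, by omega⟩
  refine ⟨?_, DAE.exists_hasNilpotentJordanForm hWK.1, fun s k hk i hi => ?_⟩
  · rw [nilpotencyClass_eq_succ_iff]
    refine ⟨hNμ, fun hν => ?_⟩
    -- If `N ^ ν` were zero, the Wong sequence would already be stationary at `ν = μ - 1`. But the
    -- two dimensions are `m_ν` and `r ν`, and `r ν < m_ν`: for `ν = 0` this is `r 0 < m`, otherwise
    -- the strict decrease of `r`.
    have heq : DAE.wongSpace E.mulVecLin F.mulVecLin (ν + 1) =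
        DAE.wongSpace E.mulVecLin F.mulVecLin ν := by
      rw [hX, hX, DAE.mulVecLin_pow, DAE.mulVecLin_pow, hν, hNμ]
    have h2 := hdim (ν + 1) le_rfl
    rw [heq, hdim ν (by omega)] at h2
    cases ν with
    | zero => exact hr0.ne' h2
    | succ ν => exact (hr ν (by omega)).ne' h2
  -- `θ i` belongs to stage `i + 1` of the Wong sequence, hence to `im N ^ (i + 1)`, which gives the
  -- bound `i + 2` on the block order.
  · rw [← hθ i (by omega), hker, ← (Submodule.equivMapOfInjective _ hinj _).finrank_eq,
      hk.finrank_ker_inf_range_pow]
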